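/- Let $F$ be a field of characteristic $0$ and let $f(x)=b_5x^5+b_4x^4+b_3x^3+b_2x^2+b_1x+b_0\in F[x]$ be irreducible of degree $5$. Put $$A=\tfrac1{100}(20b_0b_4-8b_1b_3+3b_2^2),\quad B=\tfrac1{100}(100b_0b_5-12b_1b_4+2b_2b_3),\quad C=\tfrac1{100}(20b_1b_5-8b_2b_4+3b_3^2),$$ and define $D,E,\Phi,G\in F$ by the polynomial identity $$\frac1{1000}\det\begin{pmatrix}10b_0u+2b_1v&2b_1u+b_2v&b_2u+b_3v\\2b_1u+b_2v&b_2u+b_3v&b_3u+2b_4v\\b_2u+b_3v&b_3u+2b_4v&2b_4u+10b_5v\end{pmatrix}=Du^3+Eu^2v+\Phi uv^2+Gv^3 .$$ Let $$\begin{aligned} J_4&=5^3(B^2-4AC),\\ J_8&=2^5\cdot5^6\,[\,2A(3EG-\Phi^2)-B(9DG-E\Phi)+2C(3\Phi D-E^2)\,],\\ J_{12}&=-2^{10}\cdot5^9\cdot3^{-1}[\,4(3EG-\Phi^2)(3\Phi D-E^2)-(9DG-E\Phi)^2\,], \end{aligned}$$ and $$\begin{aligned} d_1&=-10J_4,\\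 d_2&=35J_4^2+10J_8,\\ d_3&=-60J_4^3-30J_4J_8-10J_{12},\\ d_4&=55J_4^4+30J_4^2J_8+25J_8^2+50J_4J_{12},\\ d_5&=-26J_4^5-10J_4^3J_8-44J_4J_8^2-59J_4^2J_{12}-14J_8J_{12},\\ d_6&=5J_4^6+20J_4^2J_8^2+20J_4^3J_{12}+20J_4J_8J_{12}+25J_{12}^2 . \end{aligned}$$ Let $g(x)=x^6+d_1x^5+d_2x^4+d_3x^3+d_4x^2+d_5x+d_6\in F[x]$. Then: (i) Let $K/F$ be a field extension and $\beta_i,\gamma_i\in K$ $(1\le i\le5)$ such that $f(x)=\prod_{i=1}^5(\beta_ix-\gamma_i)$ in $K[x]$. Put $D_{ij}=\gamma_i\beta_j-\beta_i\gamma_j$, and for a $5$-cycle $c=(c_1c_2c_3c_4c_5)$ put $$\delta_c=D_{c_1c_2}^2D_{c_2c_3}^2D_{c_3c_4}^2D_{c_4c_5}^2D_{c_5c_1}^2+D_{c_1c_3}^2D_{c_3c_5}^2D_{c_5c_2}^2D_{c_2c_4}^2D_{c_4c_1}^2 .$$ If $\delta_1,\dots,\delta_6$ are the values of $\delta_c$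 for $c=(12345),(12354),(12453),(12435),(12534),(13452)$ (generators of the six Sylow $5$-subgroups of $S_5$), then $d_r$ is the $r$-th elementary symmetric polynomial of $\delta_1,\dots,\delta_6$ for $r=1,\dots,6$; equivalently, $g(x)=\prod_{k=1}^6(x+\delta_k)$. (ii) $f$ is solvable by radicals over $F$ (every root of $f$ in an algebraic closure of $F$ is obtained from elements of $F$ by field operations and extraction of $n$-th roots) if and only if $g$ has a root in $F$. -/

import Mathlib

open Polynomial

namespace Quintic

/-! Throughout, `b : ℕ → F` lists the coefficients of a binary quintic form
`b 5 * x ^ 5 + b 4 * x ^ 4 * y + b 3 * x ^ 3 * y ^ 2 + b 2 * x ^ 2 * y ^ 3 + b 1 * x * y ^ 4 +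
b 0 * y ^ 5`; for a quintic polynomial `f` one takes `b = f.coeff`. -/

section Invariants

variable {F : Type*} [Field F]

/-- The coefficient `A`. -/
def covA (b : ℕ → F) : F := 1 / 100 * (20 * b 0 * b 4 - 8 * b 1 * b 3 + 3 * b 2 ^ 2)

/-- The coefficient `B`. -/
def covB (b : ℕ → F) : F := 1 / 100 * (100 * b 0 * b 5 - 12 * b 1 * b 4 + 2 * b 2 * b 3)

/-- The coefficient `C`. -/
def covC (b : ℕ → F) : F := 1 / 100 * (20 * b 1 * b 5 - 8 * b 2 * b 4 + 3 * b 3 ^ 2)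

/-- The symmetric matrix of linear forms in `u`, `v` whose determinant is
`1000 * (D u³ + E u² v + F u v² + G v³)`. -/
def covMatrix (b : ℕ → F) (u v : F) : Matrix (Fin 3) (Fin 3) F :=
  !![10 * b 0 * u + 2 * b 1 * v, 2 * b 1 * u + b 2 * v, b 2 * u + b 3 * v;
     2 * b 1 * u + b 2 * v, b 2 * u + b 3 * v, b 3 * u + 2 * b 4 * v;
     b 2 * u + b 3 * v, b 3 * u + 2 * b 4 * v, 2 * b 4 * u + 10 * b 5 * v]

/-- The coefficient of `u³` in `det (covMatrix b u v) / 1000`. -/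
def covD (b : ℕ → F) : F :=
  1 / 1000 * (20 * b 0 * b 2 * b 4 - 10 * b 0 * b 3 ^ 2 - 8 * b 1 ^ 2 * b 4
    + 4 * b 1 * b 2 * b 3 - b 2 ^ 3)

/-- The coefficient of `u² v` in `det (covMatrix b u v) / 1000`. -/
def covE (b : ℕ → F) : F :=
  1 / 1000 * (100 * b 0 * b 2 * b 5 - 20 * b 0 * b 3 * b 4 - 40 * b 1 ^ 2 * b 5
    + 4 * b 1 * b 2 * b 4 + 2 * b 1 * b 3 ^ 2 - b 2 ^ 2 * b 3)

/-- The coefficient of `u v²` in `det (covMatrix b u v) / 1000`. -/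
def covF (b : ℕ → F) : F :=
  1 / 1000 * (100 * b 0 * b 3 * b 5 - 40 * b 0 * b 4 ^ 2 - 20 * b 1 * b 2 * b 5
    + 4 * b 1 * b 3 * b 4 + 2 * b 2 ^ 2 * b 4 - b 2 * b 3 ^ 2)

/-- The coefficient of `v³` in `det (covMatrix b u v) / 1000`. -/
def covG (b : ℕ → F) : F :=
  1 / 1000 * (20 * b 1 * b 3 * b 5 - 8 * b 1 * b 4 ^ 2 - 10 * b 2 ^ 2 * b 5
    + 4 * b 2 * b 3 * b 4 - b 3 ^ 3)

/-- `covD`, `covE`, `covF`, `covG` are the coefficients of the cubic form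
`det (covMatrix b u v) / 1000` in `u`, `v`. -/
theorem covMatrix_det (b : ℕ → F) (u v : F) :
    1 / 1000 * (covMatrix b u v).det =
      covD b * u ^ 3 + covE b * u ^ 2 * v + covF b * u * v ^ 2 + covG b * v ^ 3 := by
  simp only [covMatrix, covD, covE, covF, covG, Matrix.det_fin_three, Matrix.of_apply,
    Matrix.cons_val', Matrix.cons_val_zero, Matrix.cons_val_one, Matrix.cons_val]
  ring

/-- The invariant `J₄`. -/
def J4 (b : ℕ → F) : F := 5 ^ 3 * (covB b ^ 2 - 4 * covA b * covC b)

/-- The invariant `J₈`. -/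
def J8 (b : ℕ → F) : F :=
  2 ^ 5 * 5 ^ 6 * (2 * covA b * (3 * covE b * covG b - covF b ^ 2)
    - covB b * (9 * covD b * covG b - covE b * covF b)
    + 2 * covC b * (3 * covF b * covD b - covE b ^ 2))

/-- The invariant `J₁₂`. -/
def J12 (b : ℕ → F) : F :=
  -(2 ^ 10 * 5 ^ 9 * 3⁻¹) *
    (4 * (3 * covE b * covG b - covF b ^ 2) * (3 * covF b * covD b - covE b ^ 2)
      - (9 * covD b * covG b - covE b * covF b) ^ 2)

/-- The coefficient `d₁` of the sextic resolvent. -/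
def d1 (b : ℕ → F) : F := -10 * J4 b

/-- The coefficient `d₂` of the sextic resolvent. -/
def d2 (b : ℕ → F) : F := 35 * J4 b ^ 2 + 10 * J8 b

/-- The coefficient `d₃` of the sextic resolvent. -/
def d3 (b : ℕ → F) : F := -60 * J4 b ^ 3 - 30 * J4 b * J8 b - 10 * J12 b

/-- The coefficient `d₄` of the sextic resolvent. -/
def d4 (b : ℕ → F) : F :=
  55 * J4 b ^ 4 + 30 * J4 b ^ 2 * J8 b + 25 * J8 b ^ 2 + 50 * J4 b * J12 b

/-- The coefficient `d₅` of the sextic resolvent. -/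
def d5 (b : ℕ → F) : F :=
  -26 * J4 b ^ 5 - 10 * J4 b ^ 3 * J8 b - 44 * J4 b * J8 b ^ 2 - 59 * J4 b ^ 2 * J12 b
    - 14 * J8 b * J12 b

/-- The coefficient `d₆` of the sextic resolvent. -/
def d6 (b : ℕ → F) : F :=
  5 * J4 b ^ 6 + 20 * J4 b ^ 2 * J8 b ^ 2 + 20 * J4 b ^ 3 * J12 b + 20 * J4 b * J8 b * J12 b
    + 25 * J12 b ^ 2

/-- The sextic resolvent `g(x) = x⁶ + d₁ x⁵ + ⋯ + d₆` of a quintic polynomial `f`. -/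
noncomputable def sexticResolvent (f : F[X]) : F[X] :=
  X ^ 6 + C (d1 f.coeff) * X ^ 5 + C (d2 f.coeff) * X ^ 4 + C (d3 f.coeff) * X ^ 3
    + C (d4 f.coeff) * X ^ 2 + C (d5 f.coeff) * X + C (d6 f.coeff)

/-- A polynomial is solvable by radicals over `F` if all its roots in an algebraic closure of `F`
are obtained from elements of `F` by field operations and extraction of roots. -/
def SolvableByRadicals (f : F[X]) : Prop :=
  ∀ α : AlgebraicClosure F, aeval α f = 0 → α ∈ solvableByRad F (AlgebraicClosure F)

end Invariants

section Roots

variable {K : Type*} [Field K]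

/-- The bracket `D i j = det [γ i, β i; γ j, β j]` of two linear forms `β i * x - γ i * y` and
`β j * x - γ j * y`. -/
def bracket (β γ : Fin 5 → K) (i j : Fin 5) : K := γ i * β j - β i * γ j

/-- Cyclic orders of the five vertices generating the six Sylow `5`-subgroups of `S₅`:
`(12345)`, `(12354)`, `(12453)`, `(12435)`, `(12534)`, `(13452)` (with vertices renumbered from
`0`). -/
def pentagon : Fin 6 → Fin 5 → Fin 5 :=
  ![![0, 1, 2, 3, 4], ![0, 1, 2, 4, 3], ![0, 1, 3, 4, 2],
    ![0, 1, 3, 2, 4], ![0, 1, 4, 2, 3], ![0, 2, 3, 4, 1]]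

/-- `δ k`: the product of the squared brackets over the edges of the `k`-th pentagon plus the
same product over the edges of the opposite pentagon (the pentagram on the same vertices). -/
def delta (β γ : Fin 5 → K) (k : Fin 6) : K :=
  ∏ i : Fin 5, bracket β γ (pentagon k i) (pentagon k (i + 1)) ^ 2
    + ∏ i : Fin 5, bracket β γ (pentagon k i) (pentagon k (i + 2)) ^ 2

end Roots

end Quintic

/-!
The argument has an invariant-theoretic and a group-theoretic half.

For the factorization of the resolvent, both its coefficients (polynomials in `J₄`, `J₈`, `J₁₂`) and
the six numbers `δ` are unchanged if the linear forms `β i * x - γ i * y` undergo a translation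
`x ↦ x - t * y` or if `x` and `y` are exchanged (`IsTranslate.sameInvariants`,
`IsReversal.sameInvariants`). Hence two of the five points of the projective line may be moved to
`∞` and `0` (`induction_on_normalized`), which kills the extreme coefficients `b₀` and `b₅`. The
cyclic permutations of the other three points split the `δ` into two triples, and the elementary
symmetric polynomials of each triple are of the form `u ± v * D` with `D` a square root of the
discriminant of the remaining cubic and `u`, `v` polynomials in three simple quantities. This leaves
identities small enough to be verified by expansion (`resolvent_and_disc`), and shows at the same
time that five times the discriminant is `J₄² - 4 * J₈`.

For the criterion, the roots are numbered such that the Galois group contains the standard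
`5`-cycle. By Sylow's theorem and Jordan's theorem on `3`-cycles such a group either lies in the
Frobenius group of affine permutations or contains the alternating group
(`isAffine_or_alternatingGroup_le`). In the first case it is solvable, and the first `δ` is fixed by
it, so that the resolvent has a rational root. In the second case it is not solvable and permutes
the `δ` transitively; a rational root would make all of them equal, so that the resolvent would be a
sixth power, whence `J₄ = J₈ = 0` and the discriminant would vanish (`not_delta_eq_const`). Finally,
solvability of the Galois group is equivalent to solvability by radicals. One direction is in
Mathlib; the other holds since by Kummer theory a field closed under the extraction of roots has no
nontrivial solvable Galois extension
(`eq_bot_of_isSolvable`).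
-/

namespace Quintic

/-! ### Products of linear forms -/

section Forms

variable {K : Type*} [Field K]

/-- The product of the linear polynomials `β i * X - γ i`. Its coefficients are those of the binary
quintic form with linear factors `β i * x - γ i * y`. -/
noncomputable def prodLinear (β γ : Fin 5 → K) : K[X] := ∏ i, (C (β i) * X - C (γ i))

/-- The product of the squared brackets over all pairs: the discriminant of the quintic form. -/
def bracketDisc (β γ : Fin 5 → K) : K :=
  (bracket β γ 0 1 * bracket β γ 0 2 * bracket β γ 0 3 * bracket β γ 0 4 * bracket β γ 1 2 *
    bracket β γ 1 3 * bracket β γ 1 4 * bracket β γ 2 3 * bracket β γ 2 4 * bracket β γ 3 4) ^ 2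

theorem coeff_linear_mul_zero (p q : K) (P : K[X]) :
    ((C p * X - C q) * P).coeff 0 = -(q * P.coeff 0) := by
  simp [sub_mul, mul_assoc]

theorem coeff_linear_mul_succ (p q : K) (P : K[X]) (n : ℕ) :
    ((C p * X - C q) * P).coeff (n + 1) = p * P.coeff n - q * P.coeff (n + 1) := by
  simp [sub_mul, mul_assoc]

theorem prodLinear_eq_nested (β γ : Fin 5 → K) : prodLinear β γ =
    (C (β 0) * X - C (γ 0)) * ((C (β 1) * X - C (γ 1)) * ((C (β 2) * X - C (γ 2)) *
      ((C (β 3) * X - C (γ 3)) * ((C (β 4) * X - C (γ 4)) * 1)))) := by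
  rw [prodLinear, Fin.prod_univ_five]
  ring

theorem coeff_one_succ (n : ℕ) : (1 : K[X]).coeff (n + 1) = 0 := by
  simp [coeff_one]

theorem prodLinear_coeff_five (β γ : Fin 5 → K) :
    (prodLinear β γ).coeff 5 = β 0 * β 1 * β 2 * β 3 * β 4 := by
  simp only [prodLinear_eq_nested, coeff_linear_mul_succ, coeff_one_zero, coeff_one_succ]
  ring

/-! ### Translation and reversal of a quintic form -/

/-- `b'` lists the coefficients of the form obtained from the one with coefficients `b` by the
substitution `x ↦ x - t * y`. -/
def IsTranslate (t : K) (b b' : ℕ → K) : Prop :=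
  b' 5 = b 5 ∧ b' 4 = b 4 - 5 * t * b 5 ∧ b' 3 = b 3 - 4 * t * b 4 + 10 * t ^ 2 * b 5 ∧
    b' 2 = b 2 - 3 * t * b 3 + 6 * t ^ 2 * b 4 - 10 * t ^ 3 * b 5 ∧
    b' 1 = b 1 - 2 * t * b 2 + 3 * t ^ 2 * b 3 - 4 * t ^ 3 * b 4 + 5 * t ^ 4 * b 5 ∧
    b' 0 = b 0 - t * b 1 + t ^ 2 * b 2 - t ^ 3 * b 3 + t ^ 4 * b 4 - t ^ 5 * b 5

/-- `b'` lists the coefficients of the form obtained from the one with coefficients `b` by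
exchanging `x` and `y` and changing the sign. -/
def IsReversal (b b' : ℕ → K) : Prop :=
  b' 0 = -b 5 ∧ b' 1 = -b 4 ∧ b' 2 = -b 3 ∧ b' 3 = -b 2 ∧ b' 4 = -b 1 ∧ b' 5 = -b 0

theorem isTranslate_prodLinear (β γ : Fin 5 → K) (t : K) :
    IsTranslate t (prodLinear β γ).coeff (prodLinear β fun i => γ i + t * β i).coeff := by
  simp only [IsTranslate, prodLinear_eq_nested, coeff_linear_mul_succ, coeff_linear_mul_zero,
    coeff_one_zero, coeff_one_succ]
  refine ⟨?_, ?_, ?_, ?_, ?_, ?_⟩ <;> ring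

theorem isReversal_prodLinear (β γ : Fin 5 → K) :
    IsReversal (prodLinear β γ).coeff (prodLinear γ β).coeff := by
  simp only [IsReversal, prodLinear_eq_nested, coeff_linear_mul_succ, coeff_linear_mul_zero,
    coeff_one_zero, coeff_one_succ]
  refine ⟨?_, ?_, ?_, ?_, ?_, ?_⟩ <;> ring

section Invariance

variable [CharZero K] {t : K} {b b' : ℕ → K}

/-- The quadratic covariant `C x² + B x y + A y²` follows the substitution `x ↦ x - t * y`. -/
theorem IsTranslate.quadratic (h : IsTranslate t b b') :
    covA b' = covA b - t * covB b + t ^ 2 * covC b ∧ covB b' = covB b - 2 * t * covC b ∧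
      covC b' = covC b := by
  obtain ⟨h5, h4, h3, h2, h1, h0⟩ := h
  simp only [covA, covB, covC, h0, h1, h2, h3, h4, h5]
  refine ⟨?_, ?_, ?_⟩ <;> ring

/-- The cubic covariant `G x³ + F x² y + E x y² + D y³` follows the substitution
`x ↦ x - t * y`. -/
theorem IsTranslate.cubic (h : IsTranslate t b b') :
    covD b' = covD b - t * covE b + t ^ 2 * covF b - t ^ 3 * covG b ∧
      covE b' = covE b - 2 * t * covF b + 3 * t ^ 2 * covG b ∧
      covF b' = covF b - 3 * t * covG b ∧ covG b' = covG b := by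
  obtain ⟨h5, h4, h3, h2, h1, h0⟩ := h
  simp only [covD, covE, covF, covG, h0, h1, h2, h3, h4, h5]
  refine ⟨?_, ?_, ?_, ?_⟩ <;> ring

/-- The invariants `J₄`, `J₈`, `J₁₂` of `b` and `b'` agree. -/
def SameInvariants (b b' : ℕ → K) : Prop := J4 b' = J4 b ∧ J8 b' = J8 b ∧ J12 b' = J12 b

theorem IsTranslate.sameInvariants (h : IsTranslate t b b') : SameInvariants b b' := by
  obtain ⟨hA, hB, hC⟩ := h.quadratic
  obtain ⟨hD, hE, hF, hG⟩ := h.cubic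
  simp only [SameInvariants, J4, J8, J12, hA, hB, hC, hD, hE, hF, hG]
  refine ⟨?_, ?_, ?_⟩ <;> ring

theorem IsReversal.sameInvariants (h : IsReversal b b') : SameInvariants b b' := by
  obtain ⟨h0, h1, h2, h3, h4, h5⟩ := h
  have hA : covA b' = covC b := by simp only [covA, covC, h0, h1, h2, h3, h4]; ring
  have hB : covB b' = covB b := by simp only [covB, h0, h1, h2, h3, h4, h5]; ring
  have hC : covC b' = covA b := by simp only [covA, covC, h1, h2, h3, h4, h5]; ring
  have hD : covD b' = -covG b := by simp only [covD, covG, h0, h1, h2, h3, h4]; ring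
  have hE : covE b' = -covF b := by simp only [covE, covF, h0, h1, h2, h3, h4, h5]; ring
  have hF : covF b' = -covE b := by simp only [covE, covF, h0, h1, h2, h3, h4, h5]; ring
  have hG : covG b' = -covD b := by simp only [covD, covG, h1, h2, h3, h4, h5]; ring
  simp only [SameInvariants, J4, J8, J12, hA, hB, hC, hD, hE, hF, hG]
  refine ⟨?_, ?_, ?_⟩ <;> ring

end Invariance

theorem bracket_translate (β γ : Fin 5 → K) (t : K) (i j : Fin 5) :
    bracket β (fun i => γ i + t * β i) i j = bracket β γ i j := by
  simp only [bracket]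
  ring

theorem bracket_swap (β γ : Fin 5 → K) (i j : Fin 5) :
    bracket γ β i j = -bracket β γ i j := by
  simp only [bracket]
  ring

/-- To prove a property of two families, invariant under translations and the exchange of the
variables, it suffices to treat the case that the first two of the five points are `∞` and `0`. -/
theorem induction_on_normalized {P : (Fin 5 → K) → (Fin 5 → K) → Prop}
    (translate : ∀ β γ t, P β (fun i => γ i + t * β i) → P β γ)
    (swap : ∀ β γ, P γ β → P β γ)
    (base : ∀ β γ, β 0 = 0 → γ 1 = 0 → P β γ)
    (β γ : Fin 5 → K) (h : bracket β γ 0 1 ≠ 0) : P β γ := by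
  have key : ∀ β γ, bracket β γ 0 1 ≠ 0 → β 0 = 0 → P β γ := by
    intro β γ h h0
    have h1 : β 1 ≠ 0 := by
      intro h1
      exact h (by simp [bracket, h0, h1])
    refine translate β γ (-γ 1 / β 1) (base _ _ h0 ?_)
    field_simp
    ring
  by_cases h0 : β 0 = 0
  · exact key β γ h h0
  · refine translate β γ (-γ 0 / β 0) (swap _ _ (key _ _ ?_ ?_))
    · rw [bracket_swap, bracket_translate]
      exact neg_ne_zero.2 h
    · field_simp
      ring

end Forms

/-! ### The six values `δ` in normalized coordinates -/

section Normalized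

variable {K : Type*} [Field K]

/-- The coefficients of the form if the first two points are `∞` and `0`, that is, of
`-(γ 0 * β 1 * x * y)` times the product of the last three linear factors. -/
theorem prodLinear_coeff_normalized {β γ : Fin 5 → K} (h0 : β 0 = 0) (h1 : γ 1 = 0) :
    (prodLinear β γ).coeff 0 = 0 ∧ (prodLinear β γ).coeff 5 = 0 ∧
    (prodLinear β γ).coeff 1 = γ 0 * β 1 * (γ 2 * γ 3 * γ 4) ∧
    (prodLinear β γ).coeff 2 =
      -(γ 0 * β 1 * (β 2 * γ 3 * γ 4 + γ 2 * β 3 * γ 4 + γ 2 * γ 3 * β 4)) ∧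
    (prodLinear β γ).coeff 3 =
      γ 0 * β 1 * (β 2 * β 3 * γ 4 + β 2 * γ 3 * β 4 + γ 2 * β 3 * β 4) ∧
    (prodLinear β γ).coeff 4 = -(γ 0 * β 1 * (β 2 * β 3 * β 4)) := by
  simp only [prodLinear_eq_nested, coeff_linear_mul_succ, coeff_linear_mul_zero,
    coeff_one_zero, coeff_one_succ, h0, h1]
  refine ⟨?_, ?_, ?_, ?_, ?_, ?_⟩ <;> ring

/-- The common shape of the values `delta β γ k` when the first two points are `∞` and `0` and
`w = γ 0 * β 1`: here `(p, q)`, `(p', q')`, `(p'', q'')` are the other three points in the order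
in which the pentagon visits them, starting from the neighbour of the second point. -/
def deltaNormalized (w p q p' q' p'' q'' : K) : K :=
  w ^ 4 * ((q * (q * p' - p * q') * (q' * p'' - p' * q'') * p'') ^ 2 +
    (p' * (q'' * p - p'' * q) * p * q' * q'') ^ 2)

theorem delta_normalized {β γ : Fin 5 → K} (h0 : β 0 = 0) (h1 : γ 1 = 0) :
    delta β γ 0 = deltaNormalized (γ 0 * β 1) (β 2) (γ 2) (β 3) (γ 3) (β 4) (γ 4) ∧
    delta β γ 1 = deltaNormalized (γ 0 * β 1) (β 2) (γ 2) (β 4) (γ 4) (β 3) (γ 3) ∧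
    delta β γ 2 = deltaNormalized (γ 0 * β 1) (β 3) (γ 3) (β 4) (γ 4) (β 2) (γ 2) ∧
    delta β γ 3 = deltaNormalized (γ 0 * β 1) (β 3) (γ 3) (β 2) (γ 2) (β 4) (γ 4) ∧
    delta β γ 4 = deltaNormalized (γ 0 * β 1) (β 4) (γ 4) (β 2) (γ 2) (β 3) (γ 3) ∧
    delta β γ 5 = deltaNormalized (γ 0 * β 1) (β 4) (γ 4) (β 3) (γ 3) (β 2) (γ 2) := by
  refine ⟨?_, ?_, ?_, ?_, ?_, ?_⟩ <;>
  · simp [delta, Fin.prod_univ_five, pentagon, bracket, deltaNormalized, h0, h1]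
    ring

/-- For the form `b₄x⁴y + b₃x³y² + b₂x²y³ + b₁xy⁴`, the first elementary symmetric polynomial of
three of the `δ` that are permuted cyclically along with the last three points. It is expressed by
`h = b₁b₄`, `k = b₂b₃`, `m = b₂³b₄ + b₁b₃³` and the square root `D` of the discriminant of the cubic
factor; the other three `δ` belong to `-D`. -/
def cyclicEsymm1 (h k m D : K) : K :=
  -6 * m + 2 * k ^ 2 + 19 * h * k - 9 * h ^ 2 + (6 * h - k) * D

/-- The second elementary symmetric polynomial of the same three `δ`. -/
def cyclicEsymm2 (h k m D : K) : K :=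
  9 * m ^ 2 - (8 * k ^ 2 + 33 * h * k + 20 * h ^ 2) * m + 3 / 2 * k ^ 4 + 22 * h * k ^ 3
    - 57 / 2 * h ^ 2 * k ^ 2 + 288 * h ^ 3 * k - 297 * h ^ 4
    + ((5 * k - 18 * h) * m - 3 / 2 * k ^ 3 - 25 / 2 * h * k ^ 2 + 76 * h ^ 2 * k - 36 * h ^ 3) * D

/-- The product of the same three `δ`. -/
def cyclicEsymm3 (h k m D : K) : K :=
  -4 * m ^ 3 + (9 * k ^ 2 + 2 * h * k + 38 * h ^ 2) * m ^ 2
    + (-4 * k ^ 4 - 48 * h * k ^ 3 + 216 * h ^ 2 * k ^ 2 - 730 * h ^ 3 * k + 518 * h ^ 4) * m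
    + 1 / 2 * k ^ 6 + 13 * h * k ^ 5 + 32 * h ^ 2 * k ^ 4 - 506 * h ^ 3 * k ^ 3
    + 4421 / 2 * h ^ 4 * k ^ 2 - 2763 * h ^ 5 * k + 945 * h ^ 6
    + ((12 * h - 4 * k) * m ^ 2
      + (3 * k ^ 3 + 13 * h * k ^ 2 - 78 * h ^ 2 * k + 30 * h ^ 3) * m
      - 1 / 2 * k ^ 5 - 17 / 2 * h * k ^ 4 + 43 / 2 * h ^ 2 * k ^ 3 - 15 / 2 * h ^ 3 * k ^ 2
      + 189 * h ^ 4 * k - 162 * h ^ 5) * D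

section
variable {w p q p' q' p'' q'' h k m D : K}
  (hh : h = -(w ^ 2 * (q * q' * q'') * (p * p' * p'')))
  (hk : k = -(w ^ 2 * (p * q' * q'' + q * p' * q'' + q * q' * p'') *
    (p * p' * q'' + p * q' * p'' + q * p' * p'')))
  (hm : m = w ^ 4 * ((p * q' * q'' + q * p' * q'' + q * q' * p'') ^ 3 * (p * p' * p'') +
    (q * q' * q'') * (p * p' * q'' + p * q' * p'' + q * p' * p'') ^ 3))
  (hD : D = w ^ 2 * ((q * p' - p * q') * (q' * p'' - p' * q'') * (q'' * p - p'' * q)))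
include hh hk hm hD

/-- The hypotheses express `h`, `k`, `m` and `D` by the linear factors; the three terms arise from
each other by a cyclic permutation of the last three points. -/
theorem sum_deltaNormalized :
    deltaNormalized w p q p' q' p'' q'' + deltaNormalized w p' q' p'' q'' p q +
      deltaNormalized w p'' q'' p q p' q' = cyclicEsymm1 h k m D := by
  subst hh hk hm hD
  simp only [deltaNormalized, cyclicEsymm1]
  ring

variable [CharZero K]

theorem sum_mul_deltaNormalized :
    deltaNormalized w p q p' q' p'' q'' * deltaNormalized w p' q' p'' q'' p q +
      deltaNormalized w p q p' q' p'' q'' * deltaNormalized w p'' q'' p q p' q' +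
      deltaNormalized w p' q' p'' q'' p q * deltaNormalized w p'' q'' p q p' q' =
        cyclicEsymm2 h k m D := by
  subst hh hk hm hD
  simp only [deltaNormalized, cyclicEsymm2]
  ring

set_option maxHeartbeats 2000000 in
theorem prod_deltaNormalized :
    deltaNormalized w p q p' q' p'' q'' * deltaNormalized w p' q' p'' q'' p q *
      deltaNormalized w p'' q'' p q p' q' = cyclicEsymm3 h k m D := by
  subst hh hk hm hD
  simp only [deltaNormalized, cyclicEsymm3]
  ring

end

end Normalized

/-! ### The resolvent identity -/

section Resolvent

variable {K : Type*} [Field K]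

/-- The polynomial `X⁶ + d₁X⁵ + ⋯ + d₆` attached to the coefficients `b` of a quintic form. -/
noncomputable def resolventOfCoeffs (b : ℕ → K) : K[X] :=
  X ^ 6 + C (d1 b) * X ^ 5 + C (d2 b) * X ^ 4 + C (d3 b) * X ^ 3 + C (d4 b) * X ^ 2
    + C (d5 b) * X + C (d6 b)

theorem SameInvariants.resolventOfCoeffs_eq {b b' : ℕ → K} (h : SameInvariants b b') :
    resolventOfCoeffs b' = resolventOfCoeffs b := by
  obtain ⟨h4, h8, h12⟩ := h
  simp only [resolventOfCoeffs, d1, d2, d3, d4, d5, d6, h4, h8, h12]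

/-- The discriminant of the cubic factor in normalized coordinates. -/
theorem cubic_discr_normalized (w p q p' q' p'' q'' : K) :
    (w ^ 2 * ((q * p' - p * q') * (q' * p'' - p' * q'') * (q'' * p - p'' * q))) ^ 2 =
    (-(w ^ 2 * (p * q' * q'' + q * p' * q'' + q * q' * p'') *
      (p * p' * q'' + p * q' * p'' + q * p' * p''))) ^ 2 -
    4 * (w ^ 4 * ((p * q' * q'' + q * p' * q'' + q * q' * p'') ^ 3 * (p * p' * p'') +
      (q * q' * q'') * (p * p' * q'' + p * q' * p'' + q * p' * p'') ^ 3)) +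
    18 * -(w ^ 2 * (q * q' * q'') * (p * p' * p'')) *
      -(w ^ 2 * (p * q' * q'' + q * p' * q'' + q * q' * p'') *
        (p * p' * q'' + p * q' * p'' + q * p' * p'')) -
    27 * (-(w ^ 2 * (q * q' * q'') * (p * p' * p''))) ^ 2 := by
  ring

theorem delta_swap (β γ : Fin 5 → K) : delta γ β = delta β γ := by
  funext k
  simp only [delta]
  congr 1 <;> exact Finset.prod_congr rfl fun i _ => by rw [bracket_swap, neg_sq]

theorem bracketDisc_swap (β γ : Fin 5 → K) : bracketDisc γ β = bracketDisc β γ := by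
  simp only [bracketDisc, bracket_swap β γ]
  ring

variable [CharZero K]

/-- The invariants of a form without extreme terms. -/
theorem invariants_normalized {b : ℕ → K} (h0 : b 0 = 0) (h5 : b 5 = 0) {h k m : K}
    (hh : h = b 1 * b 4) (hk : k = b 2 * b 3) (hm : m = b 2 ^ 3 * b 4 + b 1 * b 3 ^ 3) :
    J4 b = (6 * m - 2 * k ^ 2 - 19 * h * k + 9 * h ^ 2) / 5 ∧
    J8 b = (9 * m ^ 2 - (6 * k ^ 2 + 57 * h * k - 152 * h ^ 2) * m + k ^ 4 + 19 * h * k ^ 3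
      + 50 * h ^ 2 * k ^ 2 - 648 * h ^ 3 * k + 864 * h ^ 4) / 25 ∧
    J12 b = (-8 * m ^ 3 + (83 * k ^ 2 - 224 * h * k + 64 * h ^ 2) * m ^ 2
      - (36 * k ^ 4 + 684 * h * k ^ 3 - 4400 * h ^ 2 * k ^ 2 + 7872 * h ^ 3 * k
        - 4096 * h ^ 4) * m
      + 4 * k ^ 6 + 164 * h * k ^ 5 + 1004 * h ^ 2 * k ^ 4 - 13984 * h ^ 3 * k ^ 3
      + 45632 * h ^ 4 * k ^ 2 - 59904 * h ^ 5 * k + 27648 * h ^ 6) / 125 := by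
  subst hh hk hm
  simp only [J4, J8, J12, covA, covB, covC, covD, covE, covF, covG, h0, h5]
  refine ⟨?_, ?_, ?_⟩ <;> ring

set_option maxHeartbeats 1000000 in
/-- The elementary symmetric polynomials of all six `δ`, in terms of those of the two triples, are
the coefficients of the resolvent. -/
theorem coeffs_normalized {b : ℕ → K} (h0 : b 0 = 0) (h5 : b 5 = 0) {h k m D : K}
    (hh : h = b 1 * b 4) (hk : k = b 2 * b 3) (hm : m = b 2 ^ 3 * b 4 + b 1 * b 3 ^ 3)
    (hD : D ^ 2 = k ^ 2 - 4 * m + 18 * h * k - 27 * h ^ 2) :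
    d1 b = cyclicEsymm1 h k m D + cyclicEsymm1 h k m (-D) ∧
    d2 b = cyclicEsymm2 h k m D + cyclicEsymm1 h k m D * cyclicEsymm1 h k m (-D)
      + cyclicEsymm2 h k m (-D) ∧
    d3 b = cyclicEsymm3 h k m D + cyclicEsymm2 h k m D * cyclicEsymm1 h k m (-D)
      + cyclicEsymm1 h k m D * cyclicEsymm2 h k m (-D) + cyclicEsymm3 h k m (-D) ∧
    d4 b = cyclicEsymm3 h k m D * cyclicEsymm1 h k m (-D)
      + cyclicEsymm2 h k m D * cyclicEsymm2 h k m (-D)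
      + cyclicEsymm1 h k m D * cyclicEsymm3 h k m (-D) ∧
    d5 b = cyclicEsymm3 h k m D * cyclicEsymm2 h k m (-D)
      + cyclicEsymm2 h k m D * cyclicEsymm3 h k m (-D) ∧
    d6 b = cyclicEsymm3 h k m D * cyclicEsymm3 h k m (-D) := by
  obtain ⟨e4, e8, e12⟩ := invariants_normalized h0 h5 hh hk hm
  clear hh hk hm
  -- After elimination of `m` by means of `hD` these are identities in `h`, `k` and `D`.
  obtain rfl : m = (k ^ 2 + 18 * h * k - 27 * h ^ 2 - D ^ 2) / 4 := by
    linear_combination (1 / 4) * hD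
  simp only [d1, d2, d3, d4, d5, d6, e4, e8, e12, cyclicEsymm1, cyclicEsymm2, cyclicEsymm3]
  refine ⟨?_, ?_, ?_, ?_, ?_, ?_⟩ <;> ring

/-- The resolvent identity and the expression of the discriminant by invariants, in normalized
coordinates. -/
theorem resolvent_and_disc_normalized {β γ : Fin 5 → K} (hβ : β 0 = 0) (hγ : γ 1 = 0) :
    resolventOfCoeffs (prodLinear β γ).coeff = ∏ k, (X + C (delta β γ k)) ∧
    5 * bracketDisc β γ =
      J4 (prodLinear β γ).coeff ^ 2 - 4 * J8 (prodLinear β γ).coeff := by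
  obtain ⟨h0, h5, h1, h2, h3, h4⟩ := prodLinear_coeff_normalized hβ hγ
  obtain ⟨e0, e1, e2, e3, e4, e5⟩ := delta_normalized hβ hγ
  generalize hw : γ 0 * β 1 = w at *
  obtain ⟨h, hh⟩ : ∃ h, h = -(w ^ 2 * (γ 2 * γ 3 * γ 4) * (β 2 * β 3 * β 4)) := ⟨_, rfl⟩
  obtain ⟨k, hk⟩ : ∃ k, k = -(w ^ 2 * (β 2 * γ 3 * γ 4 + γ 2 * β 3 * γ 4 + γ 2 * γ 3 * β 4) *
    (β 2 * β 3 * γ 4 + β 2 * γ 3 * β 4 + γ 2 * β 3 * β 4)) := ⟨_, rfl⟩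
  obtain ⟨m, hm⟩ : ∃ m, m = w ^ 4 *
    ((β 2 * γ 3 * γ 4 + γ 2 * β 3 * γ 4 + γ 2 * γ 3 * β 4) ^ 3 * (β 2 * β 3 * β 4) +
    (γ 2 * γ 3 * γ 4) * (β 2 * β 3 * γ 4 + β 2 * γ 3 * β 4 + γ 2 * β 3 * β 4) ^ 3) := ⟨_, rfl⟩
  obtain ⟨D, hD⟩ : ∃ D, D = w ^ 2 * ((γ 2 * β 3 - β 2 * γ 3) * (γ 3 * β 4 - β 3 * γ 4) *
    (γ 4 * β 2 - β 4 * γ 2)) := ⟨_, rfl⟩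
  have hdisc : D ^ 2 = k ^ 2 - 4 * m + 18 * h * k - 27 * h ^ 2 := by
    rw [hh, hk, hm, hD]
    exact cubic_discr_normalized ..
  have hh' : h = (prodLinear β γ).coeff 1 * (prodLinear β γ).coeff 4 := by
    rw [hh, h1, h4]; ring
  have hk' : k = (prodLinear β γ).coeff 2 * (prodLinear β γ).coeff 3 := by
    rw [hk, h2, h3]; ring
  have hm' : m = (prodLinear β γ).coeff 2 ^ 3 * (prodLinear β γ).coeff 4 +
      (prodLinear β γ).coeff 1 * (prodLinear β γ).coeff 3 ^ 3 := by
    rw [hm, h1, h2, h3, h4]; ring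
  constructor
  · have s1 := sum_deltaNormalized hh hk hm hD
    have s2 := sum_mul_deltaNormalized hh hk hm hD
    have s3 := prod_deltaNormalized hh hk hm hD
    have g : h = -(w ^ 2 * (γ 2 * γ 4 * γ 3) * (β 2 * β 4 * β 3)) := by rw [hh]; ring
    have g' : k = -(w ^ 2 * (β 2 * γ 4 * γ 3 + γ 2 * β 4 * γ 3 + γ 2 * γ 4 * β 3) *
        (β 2 * β 4 * γ 3 + β 2 * γ 4 * β 3 + γ 2 * β 4 * β 3)) := by rw [hk]; ring
    have g'' : m = w ^ 4 *
        ((β 2 * γ 4 * γ 3 + γ 2 * β 4 * γ 3 + γ 2 * γ 4 * β 3) ^ 3 * (β 2 * β 4 * β 3) +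
        (γ 2 * γ 4 * γ 3) * (β 2 * β 4 * γ 3 + β 2 * γ 4 * β 3 + γ 2 * β 4 * β 3) ^ 3) := by
      rw [hm]; ring
    -- The remaining three `δ` are obtained by a transposition, which changes the sign of `D`.
    have gD : -D = w ^ 2 * ((γ 2 * β 4 - β 2 * γ 4) * (γ 4 * β 3 - β 4 * γ 3) *
        (γ 3 * β 2 - β 3 * γ 2)) := by rw [hD]; ring
    have t1 := sum_deltaNormalized g g' g'' gD
    have t2 := sum_mul_deltaNormalized g g' g'' gD
    have t3 := prod_deltaNormalized g g' g'' gD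
    obtain ⟨c1, c2, c3, c4, c5, c6⟩ := coeffs_normalized h0 h5 hh' hk' hm' hdisc
    rw [← e0, ← e2, ← e4] at s1 s2 s3
    rw [← e1, ← e3, ← e5] at t1 t2 t3
    rw [resolventOfCoeffs, c1, c2, c3, c4, c5, c6, ← s1, ← s2, ← s3, ← t1, ← t2, ← t3]
    simp only [Fin.prod_univ_six, map_add, map_mul]
    ring
  · obtain ⟨i4, i8, -⟩ := invariants_normalized h0 h5 hh' hk' hm'
    have hb : bracketDisc β γ = (h * D) ^ 2 := by
      rw [hh, hD, ← hw]
      simp only [bracketDisc, bracket, hβ, hγ]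
      ring
    rw [i4, i8, hb, mul_pow, hdisc]
    ring

/-- The resolvent and the discriminant of a quintic form in terms of its linear factors, provided
that the first two of the five points are distinct. -/
theorem resolvent_and_disc (β γ : Fin 5 → K) (h : bracket β γ 0 1 ≠ 0) :
    resolventOfCoeffs (prodLinear β γ).coeff = ∏ k, (X + C (delta β γ k)) ∧
    5 * bracketDisc β γ =
      J4 (prodLinear β γ).coeff ^ 2 - 4 * J8 (prodLinear β γ).coeff := by
  refine induction_on_normalized (P := fun β γ =>
    resolventOfCoeffs (prodLinear β γ).coeff = ∏ k, (X + C (delta β γ k)) ∧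
    5 * bracketDisc β γ =
      J4 (prodLinear β γ).coeff ^ 2 - 4 * J8 (prodLinear β γ).coeff) ?_ ?_ ?_ β γ h
  · intro β γ t ih
    have hs := (isTranslate_prodLinear β γ t).sameInvariants
    rw [hs.resolventOfCoeffs_eq, hs.1, hs.2.1] at ih
    simpa only [delta, bracketDisc, bracket_translate] using ih
  · intro β γ ih
    have hs := (isReversal_prodLinear β γ).sameInvariants
    rw [hs.resolventOfCoeffs_eq, hs.1, hs.2.1] at ih
    rwa [delta_swap, bracketDisc_swap] at ih
  · intro β γ h0 h1
    exact resolvent_and_disc_normalized h0 h1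

end Resolvent

/-! ### Forms with distinct roots -/

section RootsDistinct

/-- The linear factors of a separable quintic define five distinct points of the projective
line. -/
theorem bracket_ne_zero {K : Type*} [Field K] {β γ : Fin 5 → K}
    (hsep : (prodLinear β γ).Separable) (hdeg : (prodLinear β γ).natDegree = 5)
    {i j : Fin 5} (hij : i ≠ j) : bracket β γ i j ≠ 0 := by
  have hβ : ∀ i, β i ≠ 0 := by
    have h5 : (prodLinear β γ).coeff 5 ≠ 0 := by
      rw [← hdeg]
      refine leadingCoeff_ne_zero.2 ?_
      rintro h
      simp [h] at hdeg
    rw [prodLinear_coeff_five, ← Fin.prod_univ_five] at h5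
    exact fun i => Finset.prod_ne_zero_iff.1 h5 i (Finset.mem_univ i)
  intro h
  have hcop : IsCoprime (C (β i) * X - C (γ i)) (C (β j) * X - C (γ j)) := by
    refine (hsep.of_dvd ?_).isCoprime
    rw [← Finset.prod_pair (f := fun i => C (β i) * X - C (γ i)) hij]
    exact Finset.prod_dvd_prod_of_subset _ _ _ (Finset.subset_univ _)
  have hr : ∀ l, γ i / β i = γ l / β l → (C (β l) * X - C (γ l)).eval (γ i / β i) = 0 := by
    intro l hl
    rw [hl]
    simp [mul_div_cancel₀ _ (hβ l)]
  obtain ⟨u, v, huv⟩ := hcop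
  have := congrArg (eval (γ i / β i)) huv
  rw [eval_add, eval_mul, eval_mul, hr i rfl, hr j] at this
  · simp at this
  · rw [div_eq_div_iff (hβ i) (hβ j)]
    rw [bracket] at h
    linear_combination h

variable {F : Type*} [Field F] {K : Type*} [Field K] [Algebra F K]

theorem map_coeff_invariants (b : ℕ → F) :
    J4 (fun n => algebraMap F K (b n)) = algebraMap F K (J4 b) ∧
    J8 (fun n => algebraMap F K (b n)) = algebraMap F K (J8 b) ∧
    J12 (fun n => algebraMap F K (b n)) = algebraMap F K (J12 b) := by
  refine ⟨?_, ?_, ?_⟩ <;>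
  simp only [J4, J8, J12, covA, covB, covC, covD, covE, covF, covG, map_add, map_sub, map_neg,
    map_mul, map_pow, map_div₀, map_inv₀, map_one, map_ofNat]

theorem map_sexticResolvent (f : F[X]) :
    (sexticResolvent f).map (algebraMap F K) =
      resolventOfCoeffs (f.map (algebraMap F K)).coeff := by
  obtain ⟨h4, h8, h12⟩ := map_coeff_invariants (K := K) f.coeff
  have hc : (f.map (algebraMap F K)).coeff = fun n => algebraMap F K (f.coeff n) := by
    funext n
    rw [coeff_map]
  rw [hc]
  simp only [sexticResolvent, resolventOfCoeffs, Polynomial.map_add, Polynomial.map_mul,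
    Polynomial.map_pow, map_X, map_C]
  simp only [d1, d2, d3, d4, d5, d6, h4, h8, h12, map_add, map_sub, map_neg, map_mul, map_pow,
    map_ofNat]

variable [CharZero F]

/-- The factorization of the sextic resolvent over a field over which `f` splits. -/
theorem sexticResolvent_map_eq_prod {f : F[X]} (hf : Irreducible f) (hdeg : f.natDegree = 5)
    (β γ : Fin 5 → K) (h : f.map (algebraMap F K) = prodLinear β γ) :
    (sexticResolvent f).map (algebraMap F K) = ∏ k, (X + C (delta β γ k)) := by
  have := charZero_of_injective_algebraMap (algebraMap F K).injective
  have h01 : bracket β γ 0 1 ≠ 0 := by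
    refine bracket_ne_zero ?_ ?_ (by decide)
    · exact h ▸ hf.separable.map
    · rw [← h, natDegree_map, hdeg]
  rw [map_sexticResolvent, h]
  exact (resolvent_and_disc β γ h01).1

/-- The six `δ` of a quintic form with distinct roots cannot all coincide: otherwise the resolvent
would be the sixth power of a linear polynomial, which forces `J₄ = J₈ = 0`, and the discriminant
would vanish. -/
theorem not_delta_eq_const [CharZero K] {β γ : Fin 5 → K}
    (h : ∀ i j, i ≠ j → bracket β γ i j ≠ 0) : ¬ ∃ x, ∀ k, delta β γ k = x := by
  rintro ⟨x, hx⟩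
  obtain ⟨hres, hdisc⟩ := resolvent_and_disc β γ (h 0 1 (by decide))
  set b := (prodLinear β γ).coeff
  have hexp : ∏ k, (X + C (delta β γ k)) = X ^ 6 + C (6 * x) * X ^ 5 + C (15 * x ^ 2) * X ^ 4
      + C (20 * x ^ 3) * X ^ 3 + C (15 * x ^ 4) * X ^ 2 + C (6 * x ^ 5) * X + C (x ^ 6) := by
    simp only [hx, Fin.prod_univ_six, map_mul, map_pow, map_ofNat]
    ring
  rw [hexp, resolventOfCoeffs] at hres
  have c5 := congrArg (coeff · 5) hres
  have c4 := congrArg (coeff · 4) hres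
  have c3 := congrArg (coeff · 3) hres
  have c2 := congrArg (coeff · 2) hres
  simp only [coeff_add, coeff_C_mul, coeff_X_pow, coeff_X, coeff_C, d1, d2, d3, d4] at c5 c4 c3 c2
  norm_num at c5 c4 c3 c2
  -- The leading coefficients determine the invariants in terms of `x`, and the next one forces
  -- `x = 0`.
  have e4 : J4 b = -(3 / 5) * x := by linear_combination (-1 / 10) * c5
  rw [e4] at c4 c3 c2
  have e8 : J8 b = 6 / 25 * x ^ 2 := by linear_combination (1 / 10) * c4
  rw [e8] at c3 c2
  have e12 : J12 b = -(34 / 125) * x ^ 3 := by linear_combination (-1 / 10) * c3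
  rw [e12] at c2
  have hx0 : x = 0 := by
    have : x ^ 4 = 0 := by linear_combination (25 / 108) * c2
    exact pow_eq_zero_iff (by norm_num) |>.1 this
  rw [e4, e8, hx0] at hdisc
  have hne : bracketDisc β γ ≠ 0 := by
    simp only [bracketDisc]
    refine pow_ne_zero _ ?_
    repeat' refine mul_ne_zero ?_ ?_
    all_goals exact h _ _ (by decide)
  apply hne
  linear_combination (1 / 5) * hdisc

end RootsDistinct

/-! ### Transitive groups of permutations of five points -/

section Permutations

open Equiv Equiv.Perm

/-- A permutation of the vertices `0, …, 4` of the standard pentagon is affine if it has constant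
increments modulo `5`; these are the elements of the Frobenius group of order `20`. -/
def IsAffine (τ : Perm (Fin 5)) : Prop := ∃ a : Fin 5, ∀ i, τ (i + 1) = τ i + a

theorem eq_affine_of_increment {t : ZMod 5 → ZMod 5} {a : ZMod 5} (h : ∀ i, t (i + 1) = t i + a)
    (i : ZMod 5) : t i = a * i + t 0 := by
  have key : ∀ n : ℕ, t n = a * n + t 0 := by
    intro n
    induction n with
    | zero => simp
    | succ n ih =>
      rw [Nat.cast_succ, h, ih]
      ring
  simpa using key i.val

theorem finRotate_five_pow_apply (n : ℕ) (i : Fin 5) :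
    (finRotate 5 ^ n) i = i + Fin.ofNat 5 n := by
  induction n with
  | zero => simp
  | succ n ih =>
    rw [pow_succ', Perm.mul_apply, ih, finRotate_apply, add_assoc]
    congr 1
    ext
    simp [Fin.val_add]

theorem orderOf_finRotate_five : orderOf (finRotate 5) = 5 := by
  have := Fact.mk Nat.prime_five
  refine orderOf_eq_prime ?_ ?_
  · ext i
    rw [finRotate_five_pow_apply]
    simp
  · decide

/-- The normalizer of the rotations consists of affine permutations. -/
theorem isAffine_of_conj_mem {τ : Perm (Fin 5)}
    (h : τ * finRotate 5 * τ⁻¹ ∈ Subgroup.zpowers (finRotate 5)) : IsAffine τ := by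
  rw [← mem_powers_iff_mem_zpowers] at h
  obtain ⟨n, hn⟩ := h
  refine ⟨Fin.ofNat 5 n, fun i => ?_⟩
  have := congrArg (fun π : Perm (Fin 5) => π (τ i)) hn
  have hinv : τ⁻¹ (τ i) = i := τ.symm_apply_apply i
  simp only [finRotate_five_pow_apply, Perm.mul_apply, hinv, finRotate_apply] at this
  exact this.symm

theorem isThreeCycle_of_orderOf {τ : Perm (Fin 5)} (h : orderOf τ = 3) : τ.IsThreeCycle := by
  obtain ⟨n, hn⟩ := cycleType_prime_order (σ := τ) (by rw [h]; norm_num)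
  have hs := sum_cycleType_le τ
  rw [hn, h, Multiset.sum_replicate, Fintype.card_fin] at hs
  obtain rfl : n = 0 := by
    simp only [smul_eq_mul] at hs
    omega
  rw [IsThreeCycle, hn, h]
  rfl

/-- A group of permutations of five points containing the standard `5`-cycle either consists of
affine permutations or contains the alternating group: it has one or six Sylow `5`-subgroups, and
in the latter case it contains a `3`-cycle. -/
theorem isAffine_or_alternatingGroup_le {G : Subgroup (Perm (Fin 5))} (hG : finRotate 5 ∈ G) :
    (∀ τ ∈ G, IsAffine τ) ∨ alternatingGroup (Fin 5) ≤ G := by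
  have := Fact.mk Nat.prime_five
  let c : G := ⟨finRotate 5, hG⟩
  have hc : orderOf c = 5 := by
    exact (Subgroup.orderOf_mk _ hG).trans orderOf_finRotate_five
  have hdvd : Nat.card G ∣ 120 := by
    have := Subgroup.card_subgroup_dvd_card G
    rwa [Nat.card_eq_fintype_card (α := Perm (Fin 5)), Fintype.card_perm, Fintype.card_fin] at this
  obtain ⟨r, hr⟩ : 5 ∣ Nat.card G := by
    have h := orderOf_dvd_natCard c
    rwa [hc] at h
  have hr24 : r ∣ 24 := by
    rw [hr] at hdvd
    exact Nat.dvd_of_mul_dvd_mul_left (k := 5) (by norm_num) hdvd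
  have hr5 : ¬ 5 ∣ r := fun h => absurd (h.trans hr24) (by norm_num)
  have hr0 : r ≠ 0 := by
    rintro rfl
    simp at hr24
  have hcard : Nat.card (Subgroup.zpowers c) = 5 ^ (Nat.card G).factorization 5 := by
    rw [Nat.card_zpowers, hc, hr, Nat.factorization_mul (by norm_num) hr0]
    simp [Nat.factorization_eq_zero_of_not_dvd hr5, Nat.prime_five.factorization_self]
  let P : Sylow 5 G := Sylow.ofCard _ hcard
  have hPindex : P.index = r := by
    have h1 := (Subgroup.zpowers c).card_mul_index
    rw [Nat.card_zpowers, hc, hr] at h1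
    exact Nat.eq_of_mul_eq_mul_left (by norm_num) h1
  have hndvd : Nat.card (Sylow 5 G) ∣ r := hPindex ▸ P.card_dvd_index
  have hmod := card_sylow_modEq_one 5 G
  have hn : Nat.card (Sylow 5 G) = 1 ∨ Nat.card (Sylow 5 G) = 6 := by
    have hmem : Nat.card (Sylow 5 G) ∈ Nat.divisors 24 :=
      Nat.mem_divisors.2 ⟨hndvd.trans hr24, by norm_num⟩
    generalize Nat.card (Sylow 5 G) = n at hmod hmem
    have key : ∀ n ∈ Nat.divisors 24, n ≡ 1 [MOD 5] → n = 1 ∨ n = 6 := by decide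
    exact key n hmem hmod
  rcases hn with hn | hn
  · left
    intro τ hτ
    have : Subsingleton (Sylow 5 G) := (Nat.card_eq_one_iff_unique.1 hn).1
    have hnormal : (Subgroup.zpowers c).Normal := P.normal_of_subsingleton
    have hmem := hnormal.conj_mem c (Subgroup.mem_zpowers c) ⟨τ, hτ⟩
    obtain ⟨n, hn⟩ := hmem
    refine isAffine_of_conj_mem ⟨n, ?_⟩
    simpa [c] using congrArg Subtype.val hn
  · right
    have := Fact.mk Nat.prime_three
    have h3 : 3 ∣ Nat.card G := by
      refine Dvd.dvd.trans ?_ (hr ▸ Dvd.intro_left 5 rfl : r ∣ Nat.card G)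
      exact (by rw [hn]; norm_num : 3 ∣ Nat.card (Sylow 5 G)).trans hndvd
    obtain ⟨g, hg⟩ := exists_prime_orderOf_dvd_card' (G := G) 3 h3
    have htrans : MulAction.IsPretransitive G (Fin 5) := by
      have hmove : ∀ x : Fin 5, ∃ g : G, g • (0 : Fin 5) = x := by
        intro x
        refine ⟨c ^ (x : ℕ), ?_⟩
        change ((c ^ (x : ℕ) : G) : Perm (Fin 5)) 0 = x
        rw [SubmonoidClass.coe_pow, finRotate_five_pow_apply]
        simp
      exact MulAction.isPretransitive_iff_base (0 : Fin 5) |>.2 hmove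
    have hprim : MulAction.IsPreprimitive G (Fin 5) :=
      MulAction.IsPreprimitive.of_prime_card (by simpa using Nat.prime_five)
    refine alternatingGroup_le_of_isPreprimitive_of_isThreeCycle_mem hprim
      (isThreeCycle_of_orderOf (τ := g) ?_) g.2
    rw [← hg, Subgroup.orderOf_coe]

theorem IsAffine.apply_eq {τ : Perm (ZMod 5)} (hτ : IsAffine τ) (i : ZMod 5) :
    τ i = (τ 1 - τ 0) * i + τ 0 := by
  obtain ⟨a, ha⟩ := hτ
  change ZMod 5 at a
  have h : ∀ i : ZMod 5, τ i = a * i + τ 0 := eq_affine_of_increment (t := τ) (a := a) ha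
  rw [h i, h 1, mul_one, add_sub_cancel_right]

/-- The linear part of an affine permutation, as a homomorphism on a group of such permutations. -/
noncomputable def linearPart {G : Subgroup (Perm (ZMod 5))} (hG : ∀ τ ∈ G, IsAffine τ) :
    G →* ZMod 5 where
  toFun τ := (τ : Perm (ZMod 5)) 1 - (τ : Perm (ZMod 5)) 0
  map_one' := by simp
  map_mul' σ τ := by
    have hσ := (hG σ σ.2).apply_eq
    simp only [Subgroup.coe_mul, Perm.mul_apply]
    rw [hσ ((τ : Perm (ZMod 5)) 1), hσ ((τ : Perm (ZMod 5)) 0)]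
    ring

/-- A group of affine permutations is solvable: the linear parts commute, and so do the
translations. -/
theorem isSolvable_of_isAffine {G : Subgroup (Perm (ZMod 5))} (hG : ∀ τ ∈ G, IsAffine τ) :
    Group.IsSolvable G := by
  let φ := (linearPart hG).toHomUnits
  have hunits : Group.IsSolvable (ZMod 5)ˣ := Group.isSolvable_of_comm mul_comm
  have hker : Group.IsSolvable φ.ker := by
    have htrans : ∀ τ : φ.ker, ∀ i : ZMod 5,
        ((τ : G) : Perm (ZMod 5)) i = i + ((τ : G) : Perm (ZMod 5)) 0 := by
      intro τ i
      have h1 : ((τ : G) : Perm (ZMod 5)) 1 - ((τ : G) : Perm (ZMod 5)) 0 = 1 :=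
        congrArg Units.val τ.2
      have h := (hG (τ : G) (τ : G).2).apply_eq i
      rwa [h1, one_mul] at h
    refine Group.isSolvable_of_comm fun σ τ => ?_
    refine Subtype.ext (Subtype.ext (Equiv.ext fun i => ?_))
    change ((σ : G) : Perm (ZMod 5)) (((τ : G) : Perm (ZMod 5)) i) =
      ((τ : G) : Perm (ZMod 5)) (((σ : G) : Perm (ZMod 5)) i)
    rw [htrans σ, htrans τ i, htrans τ (((σ : G) : Perm (ZMod 5)) i), htrans σ i]
    ring
  exact Group.isSolvable_of_ker_le_range φ.ker.subtype φ (fun x hx => ⟨⟨x, hx⟩, rfl⟩)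

theorem not_isSolvable_of_alternatingGroup_le {G : Subgroup (Perm (Fin 5))}
    (hG : alternatingGroup (Fin 5) ≤ G) : ¬ Group.IsSolvable G := by
  intro h
  have h' : Group.IsSolvable (alternatingGroup (Fin 5)) :=
    Group.isSolvable_of_isSolvable_injective (Subgroup.inclusion_injective hG)
  refine Equiv.Perm.not_isSolvable_fin_5 ?_
  exact Group.isSolvable_of_ker_le_range (alternatingGroup (Fin 5)).subtype sign
    (fun x hx => ⟨⟨x, hx⟩, rfl⟩)

section Delta

variable {K : Type*} [Field K]

/-- An affine permutation maps the standard pentagon to itself or to the opposite pentagon. -/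
theorem delta_comp_of_isAffine {τ : Perm (Fin 5)} (hτ : IsAffine τ) (β γ : Fin 5 → K) :
    delta (β ∘ τ) (γ ∘ τ) 0 = delta β γ 0 := by
  obtain ⟨a, ha⟩ := hτ
  have ha2 : ∀ i, τ (i + 2) = τ i + (a + a) := by
    intro i
    rw [← add_assoc, ← ha, ← ha, add_assoc]
    rfl
  have hp : ∀ i, pentagon 0 i = i := by decide
  have hb : ∀ i j, bracket (β ∘ τ) (γ ∘ τ) i j = bracket β γ (τ i) (τ j) := fun i j => rfl
  have hsymm : ∀ i j, bracket β γ i j ^ 2 = bracket β γ j i ^ 2 := by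
    intro i j
    simp only [bracket]
    ring
  simp only [delta, hp, hb, ha, ha2]
  rw [Equiv.prod_comp τ (fun j => bracket β γ j (j + a) ^ 2),
    Equiv.prod_comp τ (fun j => bracket β γ j (j + (a + a)) ^ 2)]
  have h10 := hsymm 1 0
  have h20 := hsymm 2 0
  have h30 := hsymm 3 0
  have h40 := hsymm 4 0
  have h21 := hsymm 2 1
  have h31 := hsymm 3 1
  have h41 := hsymm 4 1
  have h32 := hsymm 3 2
  have h42 := hsymm 4 2
  have h43 := hsymm 4 3
  have ha0 : a ≠ 0 := by
    rintro rfl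
    have := ha 0
    simp at this
  fin_cases a <;> simp [Fin.prod_univ_five] at ha0 ⊢ <;>
    simp only [h10, h20, h30, h40, h21, h31, h41, h32, h42, h43] <;> ring

/-- The alternating group permutes the six `δ` transitively. -/
theorem exists_even_delta_eq (k : Fin 6) : ∃ τ ∈ alternatingGroup (Fin 5),
    ∀ β γ : Fin 5 → K, delta (β ∘ τ) (γ ∘ τ) 0 = delta β γ k := by
  have hp : ∀ i, pentagon 0 i = i := by decide
  have hbij : ∀ k, Function.Injective (pentagon k) := by decide
  let π : Perm (Fin 5) := Equiv.ofBijective (pentagon k) (Finite.injective_iff_bijective.1 (hbij k))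
  have hπ : ∀ β γ : Fin 5 → K, delta (β ∘ π) (γ ∘ π) 0 = delta β γ k := by
    intro β γ
    simp only [delta, hp]
    rfl
  -- An odd affine permutation.
  let m : Perm (Fin 5) := swap 1 2 * swap 2 4 * swap 4 3
  have hm : IsAffine m := ⟨2, by decide⟩
  have hsm : sign m = -1 := by decide
  rcases Int.units_eq_one_or (sign π) with h | h
  · exact ⟨π, mem_alternatingGroup.2 h, hπ⟩
  · refine ⟨π * m, mem_alternatingGroup.2 (by rw [map_mul, h, hsm]; rfl), fun β γ => ?_⟩
    rw [← hπ, ← delta_comp_of_isAffine hm (β ∘ π)]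
    rfl

end Delta

end Permutations

/-! ### Solvable Galois groups and radicals -/

section Radicals

/-- A nontrivial finite solvable group has a nontrivial cyclic quotient. -/
theorem exists_normal_isCyclic_quotient (G : Type*) [Group G] [Finite G] [Nontrivial G]
    [Group.IsSolvable G] : ∃ (H : Subgroup G) (_ : H.Normal), H ≠ ⊤ ∧ IsCyclic (G ⧸ H) := by
  -- A maximal subgroup above the commutator subgroup is normal; any element outside generates the
  -- quotient.
  obtain ⟨H, hH, hle⟩ := (eq_top_or_exists_le_coatom (commutator G)).resolve_left
    (Group.IsSolvable.commutator_lt_top_of_nontrivial G).ne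
  have hnormal : H.Normal := by
    refine ⟨fun h hh g => ?_⟩
    have : g * h * g⁻¹ * h⁻¹ ∈ H := hle (Subgroup.commutator_mem_commutator trivial trivial)
    simpa using H.mul_mem this hh
  refine ⟨H, hnormal, hH.1, ?_⟩
  obtain ⟨x, hx⟩ : ∃ x, x ∉ H := by
    by_contra! h
    exact hH.1 ((Subgroup.eq_top_iff' H).2 h)
  have htop : H ⊔ Subgroup.zpowers x = ⊤ := by
    refine hH.2 _ (lt_of_le_of_ne le_sup_left fun h => hx ?_)
    rw [h]
    exact Subgroup.mem_sup_right (Subgroup.mem_zpowers x)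
  refine ⟨⟨(x : G ⧸ H), fun y => ?_⟩⟩
  obtain ⟨y, rfl⟩ := QuotientGroup.mk_surjective y
  obtain ⟨h, hh, z, ⟨n, rfl⟩, rfl⟩ := Subgroup.mem_sup_of_normal_left.1
    (htop.symm ▸ Subgroup.mem_top y : y ∈ H ⊔ Subgroup.zpowers x)
  refine ⟨n, ?_⟩
  have : ((h : G) : G ⧸ H) = 1 := (QuotientGroup.eq_one_iff h).2 hh
  simp [this]

variable {F E : Type*} [Field F] [Field E] [Algebra F E] [CharZero F] [IsAlgClosed E]

open IntermediateField Module

/-- A field closed under the extraction of roots has no nontrivial solvable Galois extension: by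
Kummer theory such an extension would contain a proper radical extension. -/
theorem eq_bot_of_isSolvable {S : IntermediateField F E}
    (hS : ∀ x : E, ∀ n ≠ 0, x ^ n ∈ S → x ∈ S) (L : IntermediateField S E)
    [FiniteDimensional S L] [IsGalois S L] [Group.IsSolvable Gal(L/S)] : L = ⊥ := by
  have : CharZero E := charZero_of_injective_algebraMap (algebraMap F E).injective
  by_contra hL
  have hnt : Nontrivial Gal(L/S) := by
    by_contra h
    rw [not_nontrivial_iff_subsingleton] at h
    apply hL
    rw [← IntermediateField.finrank_eq_one_iff, ← IsGalois.card_aut_eq_finrank,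
      Nat.card_eq_one_iff_unique]
    exact ⟨h, ⟨1⟩⟩
  obtain ⟨H, hH, hne, hcyc⟩ := exists_normal_isCyclic_quotient Gal(L/S)
  let M := fixedField H
  have hcycM : IsCyclic Gal(M/S) :=
    (IsGalois.normalAutEquivQuotient H).isCyclic.1 hcyc
  have hn : finrank S M ≠ 0 := finrank_pos.ne'
  have hroots : (primitiveRoots (finrank S M) S).Nonempty := by
    have : NeZero ((finrank S M : ℕ) : E) := ⟨by exact_mod_cast hn⟩
    obtain ⟨ζ, hζ⟩ := HasEnoughRootsOfUnity.exists_primitiveRoot E (finrank S M)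
    have hmem : ζ ∈ S := hS ζ _ hn (by rw [hζ.pow_eq_one]; exact S.one_mem)
    refine ⟨⟨ζ, hmem⟩, (mem_primitiveRoots finrank_pos).2 ?_⟩
    exact IsPrimitiveRoot.of_map_of_injective (f := algebraMap S E) hζ (algebraMap S E).injective
  obtain ⟨α, ⟨s, hs⟩, hα⟩ := exists_root_adjoin_eq_top_of_isCyclic S M hroots
  have hmem : algebraMap M E α ∈ S := by
    refine hS _ _ hn ?_
    have : algebraMap M E α ^ finrank S M = algebraMap S E s := by
      rw [← map_pow, ← hs, ← IsScalarTower.algebraMap_apply]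
    rw [this]
    exact s.2
  have hbot : α ∈ (⊥ : IntermediateField S M) := by
    refine mem_bot.2 ⟨⟨_, hmem⟩, (algebraMap M E).injective ?_⟩
    rw [← IsScalarTower.algebraMap_apply]
    rfl
  rw [adjoin_simple_eq_bot_iff.2 hbot] at hα
  have h1 : finrank S M = 1 := by
    rw [← IntermediateField.finrank_top' (F := S) (E := M), ← hα, IntermediateField.finrank_bot]
  apply hne
  have hMbot : fixedField H = ⊥ := IntermediateField.finrank_eq_one_iff.1 h1
  rw [← fixingSubgroup_fixedField H, hMbot, fixingSubgroup_bot]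

/-- A root of a polynomial with solvable Galois group is obtained by radicals: over the field of all
elements obtained by radicals, the Galois group is still solvable. -/
theorem mem_solvableByRad_of_isSolvable_gal {f : F[X]} (hf : f ≠ 0) (hsol : Group.IsSolvable f.Gal)
    {x : E} (hx : aeval x f = 0) : x ∈ solvableByRad F E := by
  let S := solvableByRad F E
  let p := f.map (algebraMap F S)
  have hp : p ≠ 0 := Polynomial.map_ne_zero hf
  let L : IntermediateField S E := adjoin S (p.rootSet E)
  have hsplit : (p.map (algebraMap S E)).Splits := IsAlgClosed.splits _
  have hL : p.IsSplittingField S L := adjoin_rootSet_isSplittingField hsplit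
  have : FiniteDimensional S L := hL.finiteDimensional
  have hnormal : Normal S L := Normal.of_isSplittingField p
  have : IsGalois S L := ⟨⟩
  have hLf : (f.map (algebraMap F L)).Splits := by
    have h := hL.splits
    rwa [Polynomial.map_map, ← IsScalarTower.algebraMap_eq] at h
  have : Fact (f.map (algebraMap F L)).Splits := ⟨hLf⟩
  -- Restriction to the roots embeds the Galois group over `S` into that over `F`.
  let φ : Gal(L/S) →* f.Gal := (Gal.restrict f L).comp (AlgEquiv.restrictScalarsHom F)
  have hφ : Function.Injective φ := by
    rw [injective_iff_map_eq_one]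
    intro σ hσ
    have hfix : ∀ y ∈ p.rootSet L, σ y = y := by
      intro y hy
      have hy' : y ∈ f.rootSet L := by
        refine mem_rootSet'.2 ⟨Polynomial.map_ne_zero hf, ?_⟩
        rw [← (mem_rootSet'.1 hy).2, aeval_map_algebraMap]
      have h := Gal.restrict_smul (p := f) (σ.restrictScalars F) ⟨y, hy'⟩
      have h1 : Gal.restrict f L (σ.restrictScalars F) = 1 := hσ
      rw [h1, one_smul] at h
      exact h.symm
    have hext : (σ : L →ₐ[S] L) = AlgHom.id S L :=
      AlgHom.ext_of_adjoin_eq_top hL.adjoin_rootSet hfix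
    exact AlgEquiv.ext fun y => DFunLike.congr_fun hext y
  have : Group.IsSolvable Gal(L/S) := Group.isSolvable_of_isSolvable_injective hφ
  have hbot : L = ⊥ := eq_bot_of_isSolvable (fun x n hn hx => solvableByRad.rad_mem hn hx) L
  have hxL : x ∈ L := subset_adjoin _ _ (by
    rw [mem_rootSet, aeval_map_algebraMap]
    exact ⟨hp, hx⟩)
  rw [hbot, mem_bot] at hxL
  obtain ⟨s, rfl⟩ := hxL
  exact s.2

end Radicals

/-! ### The Galois group and the resolvent -/

section Delta

variable {K : Type*} [Field K]

theorem delta_smul (c β γ : Fin 5 → K) (k : Fin 6) :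
    delta (fun i => c i * β i) (fun i => c i * γ i) k = (∏ i, c i) ^ 4 * delta β γ k := by
  have hb : ∀ i j, bracket (fun i => c i * β i) (fun i => c i * γ i) i j =
      c i * c j * bracket β γ i j := by
    intro i j
    simp only [bracket]
    ring
  simp only [delta, hb]
  fin_cases k <;> simp [Fin.prod_univ_five, pentagon] <;> ring

theorem map_delta {K' : Type*} [Field K'] (σ : K →+* K') (β γ : Fin 5 → K) (k : Fin 6) :
    σ (delta β γ k) = delta (σ ∘ β) (σ ∘ γ) k := by
  simp [delta, bracket]

end Delta

section Main

variable {F : Type*} [Field F] [CharZero F]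

open Equiv Equiv.Perm

/-- The roots of an irreducible quintic polynomial can be numbered so that the Galois group,
as a group of permutations of the indices, contains the standard `5`-cycle. -/
theorem exists_numbering_roots {f : F[X]} (hf : Irreducible f) (hdeg : f.natDegree = 5) :
    ∃ (r : Fin 5 → f.SplittingField) (φ : Gal(f.SplittingField/F) →* Perm (Fin 5)),
      Function.Injective r ∧ Function.Injective φ ∧ (∀ σ i, σ (r i) = r (φ σ i)) ∧
      finRotate 5 ∈ φ.range ∧
      f.map (algebraMap F f.SplittingField) =
        C (algebraMap F f.SplittingField f.leadingCoeff) * ∏ i, (X - C (r i)) := by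
  have := Fact.mk Nat.prime_five
  have hsplits : (f.map (algebraMap F f.SplittingField)).Splits := SplittingField.splits f
  have := Fact.mk hsplits
  have hcard : Fintype.card (f.rootSet f.SplittingField) = 5 := by
    rw [card_rootSet_eq_natDegree hf.separable hsplits, hdeg]
  let e : Fin 5 ≃ f.rootSet f.SplittingField :=
    (Fintype.equivFinOfCardEq hcard).symm
  let φ₀ : Gal(f.SplittingField/F) →* Perm (f.rootSet f.SplittingField) :=
    (Gal.galActionHom f f.SplittingField).comp (Gal.restrict f f.SplittingField)
  have hφ₀ : ∀ σ x, (φ₀ σ x : f.SplittingField) = σ x :=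
    Gal.galActionHom_restrict f f.SplittingField
  have hφ₀inj : Function.Injective φ₀ := by
    rw [injective_iff_map_eq_one]
    intro σ hσ
    refine Gal.ext (p := f) fun x hx => ?_
    have h := hφ₀ σ ⟨x, hx⟩
    rw [hσ] at h
    exact h.symm
  let φ₁ : Gal(f.SplittingField/F) →* Perm (Fin 5) := e.symm.permCongrHom.toMonoidHom.comp φ₀
  have hφ₁ : ∀ σ i, (e (φ₁ σ i) : f.SplittingField) = σ (e i) := by
    intro σ i
    rw [← hφ₀]
    simp [φ₁]
  have hφ₁inj : Function.Injective φ₁ := e.symm.permCongrHom.injective.comp hφ₀inj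
  obtain ⟨s, hs⟩ : ∃ s : Gal(f.SplittingField/F), orderOf s = 5 := by
    have h5 : 5 ∣ Nat.card f.Gal :=
      hdeg ▸ Gal.prime_degree_dvd_card hf (by rw [hdeg]; exact Nat.prime_five)
    exact exists_prime_orderOf_dvd_card' 5 h5
  have hconj : IsConj (φ₁ s) (finRotate 5) := by
    rw [isConj_iff_cycleType_eq]
    have hone : ∀ τ : Perm (Fin 5), orderOf τ = 5 → τ.cycleType = {5} := by
      intro τ hτ
      obtain ⟨n, hn⟩ := cycleType_prime_order (σ := τ) (by rw [hτ]; exact Nat.prime_five)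
      have hle := sum_cycleType_le τ
      rw [hn, hτ, Multiset.sum_replicate, Fintype.card_fin, smul_eq_mul] at hle
      obtain rfl : n = 0 := by omega
      rw [hn, hτ]
      rfl
    rw [hone _ orderOf_finRotate_five, hone]
    rw [orderOf_injective φ₁ hφ₁inj, hs]
  obtain ⟨π, hπ⟩ := isConj_iff.1 hconj
  refine ⟨fun i => e (π⁻¹ i), (MulAut.conj π).toMonoidHom.comp φ₁, ?_, ?_, ?_, ⟨s, hπ⟩, ?_⟩
  · exact Subtype.val_injective.comp (e.injective.comp (π⁻¹).injective)
  · exact (MulAut.conj π).injective.comp hφ₁inj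
  · intro σ i
    simp [hφ₁]
  · have hnodup := nodup_roots (hf.separable.map (f := algebraMap F f.SplittingField))
    rw [hsplits.eq_prod_roots, leadingCoeff_map]
    congr 1
    classical
    rw [Equiv.prod_comp π⁻¹ (fun i => X - C (e i : f.SplittingField)),
      Equiv.prod_comp e (fun x => X - C (x : f.SplittingField)),
      ← Finset.prod_subtype (f.aroots f.SplittingField).toFinset (fun x => by simp [rootSet])
        (fun x => X - C x), Finset.prod_eq_multiset_prod, Multiset.toFinset_val,
      Multiset.dedup_eq_self.2 hnodup]

/-- The resolvent of an irreducible quintic polynomial in terms of its roots. -/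
theorem sexticResolvent_map_eq_prod_of_roots {K : Type*} [Field K] [Algebra F K] {f : F[X]}
    (hf : Irreducible f) (hdeg : f.natDegree = 5) {r : Fin 5 → K}
    (hr : f.map (algebraMap F K) = C (algebraMap F K f.leadingCoeff) * ∏ i, (X - C (r i))) :
    (sexticResolvent f).map (algebraMap F K) =
      ∏ k, (X + C (algebraMap F K f.leadingCoeff ^ 4 * delta 1 r k)) := by
  set a := algebraMap F K f.leadingCoeff
  -- The leading coefficient is absorbed into the first linear factor.
  let c : Fin 5 → K := Function.update 1 0 a
  have hc : ∏ i, c i = a := by simp [c, Fin.prod_univ_five]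
  have h := sexticResolvent_map_eq_prod hf hdeg (fun i => c i * (1 : Fin 5 → K) i)
    (fun i => c i * r i) ?_
  · simpa only [delta_smul, hc] using h
  · rw [hr, prodLinear, ← hc, map_prod, ← Finset.prod_mul_distrib]
    refine Finset.prod_congr rfl fun i _ => ?_
    simp only [Pi.one_apply, map_mul, map_one]
    ring

/-- The Galois group, numbered so as to contain the standard `5`-cycle, is either affine or contains
the alternating group. In the first case it is solvable and fixes `delta 1 r 0`, so the resolvent
has a rational root; in the second case it is not solvable, and a rational root would force all six
`δ` to coincide. -/
theorem isSolvable_gal_iff_exists_isRoot {f : F[X]} (hf : Irreducible f) (hdeg : f.natDegree = 5) :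
    Group.IsSolvable f.Gal ↔ ∃ x : F, (sexticResolvent f).IsRoot x := by
  obtain ⟨r, φ, hr, hφ, hact, hrot, hfr⟩ := exists_numbering_roots hf hdeg
  have hres := sexticResolvent_map_eq_prod_of_roots hf hdeg hfr
  have hgal : IsGalois F f.SplittingField := IsGalois.of_separable_splitting_field hf.separable
  have ha : algebraMap F f.SplittingField f.leadingCoeff ≠ 0 := by
    simpa using hf.ne_zero
  have hact' : ∀ σ k, σ (delta 1 r k) =
      delta ((1 : Fin 5 → f.SplittingField) ∘ φ σ) (r ∘ φ σ) k := by
    intro σ k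
    have h := map_delta (σ : f.SplittingField →+* f.SplittingField) 1 r k
    have h1 : ((σ : f.SplittingField →+* f.SplittingField) ∘ (1 : Fin 5 → f.SplittingField)) =
        (1 : Fin 5 → f.SplittingField) ∘ φ σ := by ext; simp
    have h2 : ((σ : f.SplittingField →+* f.SplittingField) ∘ r) = r ∘ φ σ := funext (hact σ)
    rwa [h1, h2] at h
  have hroot : ∀ x : F, (sexticResolvent f).IsRoot x ↔ ∃ k, algebraMap F f.SplittingField x =
      -(algebraMap F f.SplittingField f.leadingCoeff ^ 4 * delta 1 r k) := by
    intro x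
    rw [IsRoot, ← (algebraMap F f.SplittingField).injective.eq_iff, map_zero, ← eval_map_apply,
      hres, eval_prod, Finset.prod_eq_zero_iff]
    simp [eq_neg_iff_add_eq_zero]
  rcases isAffine_or_alternatingGroup_le hrot with haff | halt
  · refine ⟨fun _ => ?_, fun _ => ?_⟩
    · have hfix : ∀ σ : Gal(f.SplittingField/F), σ (delta 1 r 0) = delta 1 r 0 := by
        intro σ
        rw [hact', delta_comp_of_isAffine (haff _ ⟨σ, rfl⟩)]
      obtain ⟨y, hy⟩ := (IsGalois.mem_range_algebraMap_iff_fixed _).2 hfix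
      refine ⟨-(f.leadingCoeff ^ 4 * y), (hroot _).2 ⟨0, ?_⟩⟩
      rw [map_neg, map_mul, map_pow, hy]
    · have : Group.IsSolvable φ.range := isSolvable_of_isAffine haff
      exact Group.isSolvable_of_isSolvable_injective (f := φ.rangeRestrict)
        (fun σ τ h => hφ (congrArg Subtype.val h))
  · refine ⟨fun h => absurd ?_ (not_isSolvable_of_alternatingGroup_le halt), fun ⟨x, hx⟩ => ?_⟩
    · have : Group.IsSolvable Gal(f.SplittingField/F) := h
      exact Group.isSolvable_of_surjective φ.rangeRestrict_surjective
    · exfalso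
      obtain ⟨k, hk⟩ := (hroot x).1 hx
      have hconj : ∀ k, ∃ σ : Gal(f.SplittingField/F), σ (delta 1 r 0) = delta 1 r k := by
        intro k
        obtain ⟨τ, hτ, h⟩ := exists_even_delta_eq (K := f.SplittingField) k
        obtain ⟨σ, rfl⟩ := halt hτ
        exact ⟨σ, by rw [hact', ← h]⟩
      -- A rational `δ` is fixed by the Galois group, hence equal to its conjugates.
      have hfix : ∀ σ : Gal(f.SplittingField/F), σ (delta 1 r k) = delta 1 r k := by
        intro σ
        have h := congrArg σ hk
        rw [σ.commutes, map_neg, map_mul, map_pow, σ.commutes, hk, neg_inj] at h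
        exact (mul_left_cancel₀ (pow_ne_zero 4 ha) h).symm
      obtain ⟨σ, hσ⟩ := hconj k
      have h0 : delta 1 r 0 = delta 1 r k := σ.injective (by rw [hσ, hfix])
      have := charZero_of_injective_algebraMap (algebraMap F f.SplittingField).injective
      refine not_delta_eq_const (β := 1) (γ := r) ?_ ⟨delta 1 r k, fun j => ?_⟩
      · intro i j hij h
        apply hij
        apply hr
        simpa [bracket, sub_eq_zero] using h
      · obtain ⟨τ, hτ⟩ := hconj j
        rw [← hτ, h0, hfix]

/-- Solvability by radicals is solvability of the Galois group. -/
theorem solvableByRadicals_iff {f : F[X]} (hf : Irreducible f) :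
    SolvableByRadicals f ↔ Group.IsSolvable f.Gal := by
  refine ⟨fun h => ?_, fun h α hα => mem_solvableByRad_of_isSolvable_gal hf.ne_zero h hα⟩
  obtain ⟨α, hα⟩ := IsAlgClosed.exists_aeval_eq_zero (AlgebraicClosure F) f
    (degree_pos_of_irreducible hf).ne'
  exact isSolvable_gal_of_irreducible (h α hα) hf hα

end Main

end Quintic

theorem mainTheorem1 {F : Type*} [Field F] [CharZero F] (f : Polynomial F)
    (hf : Irreducible f) (hdeg : f.natDegree = 5) :
    (∀ (K : Type*) [Field K] [Algebra F K] (β γ : Fin 5 → K),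
      f.map (algebraMap F K) =
          ∏ i, (Polynomial.C (β i) * Polynomial.X - Polynomial.C (γ i)) →
        (Quintic.sexticResolvent f).map (algebraMap F K) =
          ∏ k, (Polynomial.X + Polynomial.C (Quintic.delta β γ k))) ∧
    (Quintic.SolvableByRadicals f ↔ ∃ x : F, (Quintic.sexticResolvent f).IsRoot x) :=
  ⟨fun _ _ _ β γ h => Quintic.sexticResolvent_map_eq_prod hf hdeg β γ h,
    (Quintic.solvableByRadicals_iff hf).trans (Quintic.isSolvable_gal_iff_exists_isRoot hf hdeg)⟩
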